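/- Let $k \geq 2$ and let $X$ be a disconnected compact Hausdorff space. Let $\alpha$ and $\beta$ be two commuting actions of $\mathbb{Z}/k\mathbb{Z}$ on $X$ by homeomorphisms such that $\mathrm{Fix}(\beta) = \{x \in X : \beta_m(x) = x \text{ for all } m\}$ is nonempty, and suppose there is a clopen set $Y \subseteq X$ such that $X$ is the disjoint union $Y \sqcup \alpha_1(Y) \sqcup \dots \sqcup \alpha_{k-1}(Y)$. Denote the induced actions on the C*-algebra $C(X)$ of continuous complex-valued functions, $(m, f) \mapsto f \circ \alpha_m^{-1}$ and $(m,f) \mapsto f \circ \beta_m^{-1}$, again by $\alpha$ and $\beta$. Let $C(X) \rtimes_\beta \mathbb{Z}/k\mathbb{Z}$ be the crossed product C*-algebra, whose elements are the sums $\sum_{m=0}^{k-1} a_m \mu^m$ with $a_m \in C(X)$, where $\mu$ is a unitary with $\mu^k = 1$ and $\mu a \mu^* = \beta_1(a)$ for $a \in C(X)$, and let $C^*(\mathbb{Z}/k\mathbb{Z})$ be its subalgebra spanned by $1, \mu, \dots, \mu^{k-1}$. Let $$J(C(X), \beta) = \{ f \in C([0,1], C(X) \rtimes_\beta \mathbb{Z}/k\mathbb{Z})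 : f(0) \in C^*(\mathbb{Z}/k\mathbb{Z}),\ f(1) \in C(X) \}$$ be the $\beta$-twisted join, and let $\widetilde{\alpha}$ be the action of $\mathbb{Z}/k\mathbb{Z}$ on $J(C(X), \beta)$ whose generator applies pointwise the automorphism $$\sum_{m=0}^{k-1} a_m \mu^m \mapsto \sum_{m=0}^{k-1} e^{2\pi i m/k} \alpha_1(a_m) \mu^m .$$ Then there is no unital $*$-homomorphism $\phi: C(X) \to J(C(X), \beta)$ that is $(\alpha, \widetilde{\alpha})$-equivariant, i.e. satisfies $\phi \circ \alpha_m = \widetilde{\alpha}_m \circ \phi$ for all $m \in \mathbb{Z}/k\mathbb{Z}$. -/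

import Mathlib

noncomputable section

set_option linter.unusedSectionVars false

/-! ### The crossed product of a unital C⋆-algebra by an action of a finite group -/

section CrossedProduct

open scoped CStarAlgebra

variable {A : Type*} [CStarAlgebra A] {Γ : Type*} [Group Γ] [Fintype Γ] [DecidableEq Γ]

/-- The crossed product `A ⋊_β Γ` of a unital C⋆-algebra `A` by an action `β` of a finite group `Γ`:
formal sums `∑ γ, a_γ γ` with coefficients `a_γ ∈ A`, where `γ a γ* = β_γ(a)` and each `γ` is
unitary. -/
@[ext]
structure CrossedProduct (β : Γ →* (A ≃⋆ₐ[ℂ] A)) where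
  /-- The family of coefficients `γ ↦ a_γ`. -/
  coeff : Γ → A

namespace CrossedProduct

variable {β : Γ →* (A ≃⋆ₐ[ℂ] A)}

instance : Zero (CrossedProduct β) := ⟨⟨0⟩⟩
instance : Add (CrossedProduct β) := ⟨fun x y => ⟨x.coeff + y.coeff⟩⟩
instance : Neg (CrossedProduct β) := ⟨fun x => ⟨-x.coeff⟩⟩
instance : Sub (CrossedProduct β) := ⟨fun x y => ⟨x.coeff - y.coeff⟩⟩
instance {R : Type*} [SMul R A] : SMul R (CrossedProduct β) := ⟨fun r x => ⟨r • x.coeff⟩⟩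

/-- The unit is `1 · e`, with `e` the identity of `Γ`. -/
instance : One (CrossedProduct β) := ⟨⟨Pi.single 1 1⟩⟩

/-- `(∑ a_h h) (∑ b_s s) = ∑ a_h β_h(b_s) h s`. -/
instance : Mul (CrossedProduct β) :=
  ⟨fun x y => ⟨fun g => ∑ h : Γ, x.coeff h * β h (y.coeff (h⁻¹ * g))⟩⟩

/-- `(a g)* = g* a* = β_{g⁻¹}(a*) g⁻¹`. -/
instance : Star (CrossedProduct β) :=
  ⟨fun x => ⟨fun g => β g (star (x.coeff g⁻¹))⟩⟩

theorem coeff_injective : Function.Injective (coeff : CrossedProduct β → Γ → A) :=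
  fun _ _ h => CrossedProduct.ext h

@[simp] theorem coeff_zero : (0 : CrossedProduct β).coeff = 0 := rfl
@[simp] theorem coeff_add (x y : CrossedProduct β) : (x + y).coeff = x.coeff + y.coeff := rfl
@[simp] theorem coeff_neg (x : CrossedProduct β) : (-x).coeff = -x.coeff := rfl
@[simp] theorem coeff_sub (x y : CrossedProduct β) : (x - y).coeff = x.coeff - y.coeff := rfl
@[simp] theorem coeff_smul {R : Type*} [SMul R A] (r : R) (x : CrossedProduct β) :
    (r • x).coeff = r • x.coeff := rfl
theorem coeff_one : (1 : CrossedProduct β).coeff = Pi.single 1 1 := rfl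
theorem coeff_mul (x y : CrossedProduct β) (g : Γ) :
    (x * y).coeff g = ∑ h : Γ, x.coeff h * β h (y.coeff (h⁻¹ * g)) := rfl
theorem coeff_star (x : CrossedProduct β) (g : Γ) :
    (star x).coeff g = β g (star (x.coeff g⁻¹)) := rfl

instance : AddCommGroup (CrossedProduct β) :=
  coeff_injective.addCommGroup _ rfl (fun _ _ => rfl) (fun _ => rfl) (fun _ _ => rfl)
    (fun _ _ => rfl) (fun _ _ => rfl)

instance : Module ℂ (CrossedProduct β) :=
  coeff_injective.module ℂ
    { toFun := coeff, map_zero' := rfl, map_add' := fun _ _ => rfl } (fun _ _ => rfl)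

theorem aut_mul_apply (s t : Γ) (a : A) : β (s * t) a = β s (β t a) := by
  rw [map_mul]; rfl

/-- The underlying function of the regular representation `A ⋊_β Γ → M_Γ(A)`: it sends `a ∈ A` to
the diagonal matrix with entries `β_{s⁻¹}(a)` and `γ ∈ Γ` to the permutation matrix of
`t ↦ γ t`. -/
def regularRepFun (x : CrossedProduct β) : CStarMatrix Γ Γ A :=
  CStarMatrix.ofMatrix (Matrix.of fun s t => β s⁻¹ (x.coeff (s * t⁻¹)))

theorem regularRepFun_apply (x : CrossedProduct β) (s t : Γ) :
    regularRepFun x s t = β s⁻¹ (x.coeff (s * t⁻¹)) := rfl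

theorem regularRepFun_injective :
    Function.Injective (regularRepFun : CrossedProduct β → CStarMatrix Γ Γ A) := by
  intro x y h
  ext g
  have := congrFun (congrFun h 1) g⁻¹
  simpa [regularRepFun_apply] using this

theorem regularRepFun_add (x y : CrossedProduct β) :
    regularRepFun (x + y) = regularRepFun x + regularRepFun y := by
  ext s t; simp [regularRepFun_apply]

theorem regularRepFun_zero : regularRepFun (0 : CrossedProduct β) = 0 := by
  ext s t; simp [regularRepFun_apply]

theorem regularRepFun_smul (c : ℂ) (x : CrossedProduct β) :
    regularRepFun (c • x) = c • regularRepFun x := by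
  ext s t; simp [regularRepFun_apply]

theorem regularRepFun_one : regularRepFun (1 : CrossedProduct β) = 1 := by
  ext s t
  rw [regularRepFun_apply, coeff_one, CStarMatrix.one_apply]
  by_cases h : s = t
  · subst h; simp
  · have : s * t⁻¹ ≠ 1 := fun h' => h (mul_inv_eq_one.mp h')
    simp [h, this]

theorem regularRepFun_mul (x y : CrossedProduct β) :
    regularRepFun (x * y) = regularRepFun x * regularRepFun y := by
  ext s t
  rw [regularRepFun_apply, coeff_mul, CStarMatrix.mul_apply, map_sum]
  refine Fintype.sum_equiv ((Equiv.inv Γ).trans (Equiv.mulRight s)) _ _ fun h => ?_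
  simp only [regularRepFun_apply, Equiv.trans_apply, Equiv.inv_apply, Equiv.coe_mulRight,
    map_mul (β s⁻¹), ← aut_mul_apply]
  simp [mul_assoc]

theorem regularRepFun_star (x : CrossedProduct β) :
    regularRepFun (star x) = star (regularRepFun x) := by
  ext s t
  rw [regularRepFun_apply, coeff_star, ← aut_mul_apply, CStarMatrix.star_apply,
    regularRepFun_apply, map_star]
  simp

instance : Ring (CrossedProduct β) where
  __ := (inferInstance : AddCommGroup (CrossedProduct β))
  left_distrib x y z := regularRepFun_injective <| by
    simp only [regularRepFun_add, regularRepFun_mul, mul_add]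
  right_distrib x y z := regularRepFun_injective <| by
    simp only [regularRepFun_add, regularRepFun_mul, add_mul]
  zero_mul x := regularRepFun_injective <| by
    simp only [regularRepFun_zero, regularRepFun_mul, zero_mul]
  mul_zero x := regularRepFun_injective <| by
    simp only [regularRepFun_zero, regularRepFun_mul, mul_zero]
  mul_assoc x y z := regularRepFun_injective <| by
    simp only [regularRepFun_mul, mul_assoc]
  one_mul x := regularRepFun_injective <| by
    simp only [regularRepFun_one, regularRepFun_mul, one_mul]
  mul_one x := regularRepFun_injective <| by
    simp only [regularRepFun_one, regularRepFun_mul, mul_one]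
  zsmul := fun n x => n • x
  neg_add_cancel := neg_add_cancel
  sub_eq_add_neg := sub_eq_add_neg
  zsmul_zero' := (inferInstance : AddCommGroup (CrossedProduct β)).zsmul_zero'
  zsmul_succ' := (inferInstance : AddCommGroup (CrossedProduct β)).zsmul_succ'
  zsmul_neg' := (inferInstance : AddCommGroup (CrossedProduct β)).zsmul_neg'

instance : Algebra ℂ (CrossedProduct β) :=
  Algebra.ofModule
    (fun c x y => regularRepFun_injective <| by
      simp only [regularRepFun_smul, regularRepFun_mul, smul_mul_assoc])
    (fun c x y => regularRepFun_injective <| by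
      simp only [regularRepFun_smul, regularRepFun_mul, mul_smul_comm])

instance : StarRing (CrossedProduct β) where
  star_involutive x := regularRepFun_injective <| by
    simp only [regularRepFun_star, star_star]
  star_mul x y := regularRepFun_injective <| by
    simp only [regularRepFun_star, regularRepFun_mul, star_mul]
  star_add x y := regularRepFun_injective <| by
    simp only [regularRepFun_star, regularRepFun_add, star_add]

instance : StarModule ℂ (CrossedProduct β) where
  star_smul c x := by
    ext g; simp [coeff_star, star_smul]

variable (β) in
/-- The regular representation `A ⋊_β Γ → M_Γ(A)`, a faithful unital `*`-homomorphism. -/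
def regularRep : CrossedProduct β →⋆ₐ[ℂ] CStarMatrix Γ Γ A where
  toFun := regularRepFun
  map_one' := regularRepFun_one
  map_mul' := regularRepFun_mul
  map_zero' := regularRepFun_zero
  map_add' := regularRepFun_add
  commutes' c := by
    rw [Algebra.algebraMap_eq_smul_one, Algebra.algebraMap_eq_smul_one, regularRepFun_smul,
      regularRepFun_one]
  map_star' := regularRepFun_star

/-- The C⋆-norm of the crossed product is the norm of the regular representation in the
C⋆-algebra of matrices over `A`. -/
instance : NormedRing (CrossedProduct β) :=
  letI := CStarAlgebra.spectralOrder A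
  letI := CStarAlgebra.spectralOrderedRing A
  NormedRing.induced _ (CStarMatrix Γ Γ A) (regularRep β) regularRepFun_injective

theorem isUniformInducing_regularRep :
    IsUniformInducing (regularRepFun : CrossedProduct β → CStarMatrix Γ Γ A) := ⟨rfl⟩

instance : NormedAlgebra ℂ (CrossedProduct β) where
  norm_smul_le c x := by
    let _ := CStarAlgebra.spectralOrder A
    let _ := CStarAlgebra.spectralOrderedRing A
    change ‖regularRepFun (c • x)‖ ≤ ‖c‖ * ‖regularRepFun x‖
    rw [regularRepFun_smul]
    exact norm_smul_le _ _

instance : CStarRing (CrossedProduct β) where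
  norm_mul_self_le x := by
    let _ := CStarAlgebra.spectralOrder A
    let _ := CStarAlgebra.spectralOrderedRing A
    change ‖regularRepFun x‖ * ‖regularRepFun x‖ ≤ ‖regularRepFun (star x * x)‖
    rw [regularRepFun_mul, regularRepFun_star]
    exact CStarRing.norm_mul_self_le _

/-- The range of the regular representation is cut out by finitely many continuous equations. -/
theorem range_regularRepFun :
    Set.range (regularRepFun : CrossedProduct β → CStarMatrix Γ Γ A) =
      {M | ∀ s t, M s t = β s⁻¹ (M 1 (t * s⁻¹))} := by
  ext M
  constructor
  · rintro ⟨x, rfl⟩ s t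
    simp [regularRepFun_apply]
  · intro h
    refine ⟨⟨fun g => M 1 g⁻¹⟩, ?_⟩
    ext s t
    rw [regularRepFun_apply, h s t]
    simp

instance : CompleteSpace (CrossedProduct β) := by
  rw [completeSpace_iff_isComplete_range isUniformInducing_regularRep, range_regularRepFun]
  refine IsClosed.isComplete ?_
  simp only [Set.ofPred_forall]
  refine isClosed_iInter fun s => isClosed_iInter fun t => isClosed_eq ?_ ?_
  · exact (continuous_apply t).comp (continuous_apply s)
  · exact (map_continuous (β s⁻¹)).comp ((continuous_apply _).comp (continuous_apply _))

/-- The crossed product is a unital C⋆-algebra. -/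
instance : CStarAlgebra (CrossedProduct β) where

variable (β) in
/-- The copy of `A` in `A ⋊_β Γ`: the elements `a · e`, with `e` the identity of `Γ`. -/
def coeffAlgebra : StarSubalgebra ℂ (CrossedProduct β) where
  carrier := {x | ∀ g, g ≠ 1 → x.coeff g = 0}
  mul_mem' {x y} hx hy g hg := by
    rw [coeff_mul]
    refine Finset.sum_eq_zero fun h _ => ?_
    by_cases h1 : h = 1
    · subst h1; simp [hy g hg]
    · simp [hx h h1]
  add_mem' {x y} hx hy g hg := by simp [hx g hg, hy g hg]
  algebraMap_mem' c g hg := by simp [Algebra.algebraMap_eq_smul_one, coeff_one, hg]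
  star_mem' {x} hx g hg := by simp [coeff_star, hx g⁻¹ (inv_ne_one.mpr hg)]

variable (β) in
/-- The copy of the group C⋆-algebra `C*(Γ)` in `A ⋊_β Γ`: the sums `∑ c_γ γ` with scalars `c_γ`. -/
def groupAlgebra : StarSubalgebra ℂ (CrossedProduct β) where
  carrier := {x | ∀ g, ∃ c : ℂ, x.coeff g = algebraMap ℂ A c}
  mul_mem' {x y} hx hy g := by
    choose c hc using hx
    choose d hd using hy
    refine ⟨∑ h : Γ, c h * d (h⁻¹ * g), ?_⟩
    simp only [coeff_mul, hc, hd, map_sum, map_mul, AlgHomClass.commutes]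
  add_mem' {x y} hx hy g := by
    obtain ⟨c, hc⟩ := hx g
    obtain ⟨d, hd⟩ := hy g
    exact ⟨c + d, by simp [hc, hd]⟩
  algebraMap_mem' c g := by
    by_cases hg : g = 1
    · subst hg; exact ⟨c, by simp [Algebra.algebraMap_eq_smul_one, coeff_one]⟩
    · exact ⟨0, by simp [Algebra.algebraMap_eq_smul_one, coeff_one, hg]⟩
  star_mem' {x} hx g := by
    obtain ⟨c, hc⟩ := hx g⁻¹
    refine ⟨star c, ?_⟩
    rw [coeff_star, hc, ← algebraMap_star_comm, AlgHomClass.commutes]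

/-- For an automorphism `σ` of `A` commuting with `β` and a character `χ` of `Γ`, the
`*`-endomorphism `∑ a_γ γ ↦ ∑ χ(γ) σ(a_γ) γ` of `A ⋊_β Γ`. -/
def gradedHom (σ : A ≃⋆ₐ[ℂ] A) (hσ : ∀ g, Commute σ (β g)) (χ : Γ →* Circle) :
    CrossedProduct β →⋆ₐ[ℂ] CrossedProduct β where
  toFun x := ⟨fun g => (χ g : ℂ) • σ (x.coeff g)⟩
  map_one' := by
    ext g
    by_cases hg : g = 1
    · subst hg; simp [coeff_one]
    · simp [coeff_one, hg]
  map_mul' x y := by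
    ext g
    have hc : ∀ h a, σ (β h a) = β h (σ a) := fun h a => DFunLike.congr_fun (hσ h) a
    simp only [coeff_mul, map_sum, map_mul σ, Finset.smul_sum, hc, map_smul]
    refine Finset.sum_congr rfl fun h _ => ?_
    have hχ : χ g = χ h * χ (h⁻¹ * g) := by rw [← map_mul, mul_inv_cancel_left]
    rw [smul_mul_smul_comm, hχ, Circle.coe_mul]
  map_zero' := by ext g; simp
  map_add' x y := by ext g; simp
  commutes' c := by
    ext g
    by_cases hg : g = 1
    · subst hg; simp [Algebra.algebraMap_eq_smul_one, coeff_one]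
    · simp [Algebra.algebraMap_eq_smul_one, coeff_one, hg]
  map_star' x := by
    ext g
    have hc : ∀ h a, σ (β h a) = β h (σ a) := fun h a => DFunLike.congr_fun (hσ h) a
    simp only [coeff_star, hc, map_star, star_smul, map_smul, map_inv, Circle.coe_inv_eq_conj]
    simp

@[simp] theorem gradedHom_coeff (σ : A ≃⋆ₐ[ℂ] A) (hσ : ∀ g, Commute σ (β g)) (χ : Γ →* Circle)
    (x : CrossedProduct β) (g : Γ) :
    (gradedHom σ hσ χ x).coeff g = (χ g : ℂ) • σ (x.coeff g) := rfl

end CrossedProduct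

open CrossedProduct in
/-- The `β`-twisted join `J(A, β)` of `A` and `C*(Γ)`: the continuous paths
`f : [0, 1] → A ⋊_β Γ` with `f(0) ∈ C*(Γ)` and `f(1) ∈ A`. -/
def TwistedJoin (β : Γ →* (A ≃⋆ₐ[ℂ] A)) : StarSubalgebra ℂ C(unitInterval, CrossedProduct β) where
  carrier := {f | f 0 ∈ groupAlgebra β ∧ f 1 ∈ coeffAlgebra β}
  mul_mem' hf hg := ⟨mul_mem hf.1 hg.1, mul_mem hf.2 hg.2⟩
  add_mem' hf hg := ⟨add_mem hf.1 hg.1, add_mem hf.2 hg.2⟩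
  algebraMap_mem' c := ⟨algebraMap_mem (groupAlgebra β) c, algebraMap_mem (coeffAlgebra β) c⟩
  star_mem' hf := ⟨star_mem hf.1, star_mem hf.2⟩

namespace TwistedJoin

variable {β : Γ →* (A ≃⋆ₐ[ℂ] A)}

/-- The pointwise application of `∑ a_γ γ ↦ ∑ χ(γ) σ(a_γ) γ` on `J(A, β)`. -/
def pointwiseHom (σ : A ≃⋆ₐ[ℂ] A) (hσ : ∀ g, Commute σ (β g)) (χ : Γ →* Circle) :
    TwistedJoin β →⋆ₐ[ℂ] TwistedJoin β where
  toFun f := ⟨⟨fun t => CrossedProduct.gradedHom σ hσ χ (f.1 t),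
      (map_continuous (CrossedProduct.gradedHom σ hσ χ)).comp f.1.continuous⟩, by
    constructor
    · intro g
      obtain ⟨c, hc⟩ := f.2.1 g
      refine ⟨χ g * c, ?_⟩
      simp only [ContinuousMap.coe_mk, CrossedProduct.gradedHom_coeff]
      rw [hc, AlgHomClass.commutes, map_mul, Algebra.smul_def]
    · intro g hg
      simp only [ContinuousMap.coe_mk, CrossedProduct.gradedHom_coeff]
      rw [f.2.2 g hg, map_zero, smul_zero]⟩
  map_one' := Subtype.ext <| ContinuousMap.ext fun _ => map_one (CrossedProduct.gradedHom σ hσ χ)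
  map_mul' _ _ := Subtype.ext <| ContinuousMap.ext fun _ =>
    map_mul (CrossedProduct.gradedHom σ hσ χ) _ _
  map_zero' := Subtype.ext <| ContinuousMap.ext fun _ => map_zero (CrossedProduct.gradedHom σ hσ χ)
  map_add' _ _ := Subtype.ext <| ContinuousMap.ext fun _ =>
    map_add (CrossedProduct.gradedHom σ hσ χ) _ _
  commutes' c := Subtype.ext <| ContinuousMap.ext fun _ =>
    AlgHomClass.commutes (CrossedProduct.gradedHom σ hσ χ) c
  map_star' _ := Subtype.ext <| ContinuousMap.ext fun _ =>
    map_star (CrossedProduct.gradedHom σ hσ χ) _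

@[simp] theorem pointwiseHom_coeff (σ : A ≃⋆ₐ[ℂ] A) (hσ : ∀ g, Commute σ (β g)) (χ : Γ →* Circle)
    (f : TwistedJoin β) (t : unitInterval) (g : Γ) :
    ((pointwiseHom σ hσ χ f).1 t).coeff g = (χ g : ℂ) • σ ((f.1 t).coeff g) := rfl

end TwistedJoin

end CrossedProduct

/-! ### Actions of `ℤ/kℤ` -/

section ZModActions

/-- The character `m ↦ exp(2πi j m / k)` of `ℤ/kℤ` attached to `j ∈ ℤ/kℤ`; this is the
identification of `ℤ/kℤ` with its dual group. -/
def zmodChar (k : ℕ) [NeZero k] (j : Multiplicative (ZMod k)) : Multiplicative (ZMod k) →* Circle where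
  toFun m := ZMod.toCircle (j.toAdd * m.toAdd)
  map_one' := by simp
  map_mul' m n := by simp [mul_add, AddChar.map_add_eq_mul]

theorem zmodChar_mul (k : ℕ) [NeZero k] (i j m : Multiplicative (ZMod k)) :
    zmodChar k (i * j) m = zmodChar k i m * zmodChar k j m := by
  simp [zmodChar, add_mul, AddChar.map_add_eq_mul]

/-- The action `α̃` of `ℤ/kℤ` on `J(A, β)` for commuting actions `α` and `β` of `ℤ/kℤ` on `A`: the
pointwise application of `(α β̂)_j : ∑ a_m μ^m ↦ ∑ ω^(j m) α_j(a_m) μ^m`, where `ω = exp(2πi/k)`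
and `μ` is the generator of the acting group `ℤ/kℤ` of `β`. -/
def tildeAction {A : Type*} [CStarAlgebra A] {k : ℕ} [NeZero k]
    (α β : Multiplicative (ZMod k) →* (A ≃⋆ₐ[ℂ] A)) (hαβ : ∀ i j, Commute (α i) (β j)) :
    Multiplicative (ZMod k) →* (TwistedJoin β →⋆ₐ[ℂ] TwistedJoin β) where
  toFun j := TwistedJoin.pointwiseHom (α j) (hαβ j) (zmodChar k j)
  map_one' := by
    ext f : 1
    refine Subtype.ext (ContinuousMap.ext fun t => CrossedProduct.ext (funext fun g => ?_))
    rw [TwistedJoin.pointwiseHom_coeff]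
    change _ = (f.1 t).coeff g
    simp [zmodChar]
  map_mul' i j := by
    ext f : 1
    refine Subtype.ext (ContinuousMap.ext fun t => CrossedProduct.ext (funext fun g => ?_))
    rw [TwistedJoin.pointwiseHom_coeff, zmodChar_mul, map_mul, Circle.coe_mul, mul_smul]
    change _ = ((TwistedJoin.pointwiseHom _ _ _ (TwistedJoin.pointwiseHom _ _ _ f)).1 t).coeff g
    simp

/-- The action on `C(X)` induced by an action on `X`: `α_g(f) = f ∘ α_g⁻¹`. -/
def inducedAction {Γ : Type*} [Group Γ] {X : Type*} [TopologicalSpace X] (α : Γ →* (X ≃ₜ X)) :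
    Γ →* (C(X, ℂ) ≃⋆ₐ[ℂ] C(X, ℂ)) where
  toFun g := (α g⁻¹).compStarAlgEquiv' ℂ ℂ
  map_one' := by ext f x; simp
  map_mul' g h := by ext f x; simp

theorem inducedAction_apply {Γ : Type*} [Group Γ] {X : Type*} [TopologicalSpace X]
    (α : Γ →* (X ≃ₜ X)) (g : Γ) (f : C(X, ℂ)) (x : X) :
    inducedAction α g f x = f (α g⁻¹ x) := rfl

theorem inducedAction_commute {Γ : Type*} [Group Γ] {X : Type*} [TopologicalSpace X]
    {α β : Γ →* (X ≃ₜ X)} (h : ∀ i j, Commute (α i) (β j)) (i j : Γ) :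
    Commute (inducedAction α i) (inducedAction β j) := by
  ext f x
  change f (β j⁻¹ (α i⁻¹ x)) = f (α i⁻¹ (β j⁻¹ x))
  exact congrArg f (DFunLike.congr_fun (h i⁻¹ j⁻¹) x).symm

end ZModActions

end

/-! The clopen set `Y` yields a unitary `u` in `C(X)` with `u ^ k = 1` and `α_j(u) = ω^(-j) u`,
where `ω = exp(2πi/k)` (`exists_eigenvector_pow_eq_one`). An equivariant `φ` would turn `u` into a
path of `k`-th roots of `1` in the crossed product whose two ends are incompatible. At time 0 the
coefficients are scalars, on which only the dual action is felt, so equivariance leaves a multiple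
`c μ^(-1)`; at time 1 the path is some `a` in `C(X)`. A `β`-fixed point `x` and a character `χ` of
`ℤ/kℤ` define a character of the crossed product (`CrossedProduct.fixedPointHom`). Along the path it
takes values in the `k`-th roots of unity, hence is constant (`eq_of_continuous_of_pow_eq_one`), so
`c χ(μ^(-1)) = a(x)` for every `χ`. The right side does not depend on `χ` and `c ≠ 0`, but
`χ(μ^(-1))` does vary with `χ` since `k ≥ 2`. -/

/-- A continuous function on a preconnected space whose values are `k`-th roots of unity is
constant. -/
theorem eq_of_continuous_of_pow_eq_one {T : Type*} [TopologicalSpace T] [PreconnectedSpace T]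
    {k : ℕ} (hk : 0 < k) {g : T → ℂ} (hg : Continuous g) (hpow : ∀ t, g t ^ k = 1) (s t : T) :
    g s = g t := by
  have hfin : (Set.range g).Finite := by
    refine (Polynomial.nthRootsFinset k (1 : ℂ)).finite_toSet.subset ?_
    rintro _ ⟨t, rfl⟩
    exact (Polynomial.mem_nthRootsFinset hk 1).2 (hpow t)
  -- A countable subset of `ℂ` is totally disconnected, so the preconnected range has at most one
  -- point.
  exact hfin.countable.isTotallyDisconnected _ subset_rfl (isPreconnected_range hg) ⟨s, rfl⟩ ⟨t, rfl⟩

/-- A point `x` fixed by `β` and a character `χ` of `Γ` give the character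
`∑ a_γ γ ↦ ∑ a_γ(x) χ(γ)` of the crossed product of `C(X)` by `β`. -/
noncomputable def CrossedProduct.fixedPointHom {Γ : Type*} [Group Γ] [Fintype Γ] [DecidableEq Γ] {X : Type*}
    [TopologicalSpace X] [CompactSpace X] {β : Γ →* (X ≃ₜ X)} {x : X} (hx : ∀ g, β g x = x)
    (χ : Γ →* Circle) : CrossedProduct (inducedAction β) →⋆ₐ[ℂ] ℂ where
  toFun a := ∑ g, a.coeff g x * χ g
  map_one' := by
    rw [Finset.sum_eq_single 1] <;> simp +contextual [CrossedProduct.coeff_one]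
  map_mul' a b := by
    -- Evaluation at the fixed point `x` removes the twist, `β_h(b)(x) = b(x)`. What remains is
    -- ordinary convolution over `Γ`, and pairing with `χ` is multiplicative for it.
    simp only [CrossedProduct.coeff_mul, ContinuousMap.sum_apply, ContinuousMap.mul_apply,
      inducedAction_apply, hx, Finset.sum_mul, Finset.mul_sum]
    rw [Finset.sum_comm]
    conv_rhs => rw [Finset.sum_comm]
    refine Finset.sum_congr rfl fun h _ => ?_
    refine Fintype.sum_equiv (Equiv.mulLeft h⁻¹) _ _ fun g => ?_
    have hχ : χ g = χ h * χ (h⁻¹ * g) := by rw [← map_mul, mul_inv_cancel_left]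
    rw [Equiv.coe_mulLeft, hχ, Circle.coe_mul]
    ring
  map_zero' := by simp
  map_add' a b := by simp [add_mul, Finset.sum_add_distrib]
  commutes' c := by
    rw [Finset.sum_eq_single 1] <;>
      simp +contextual [Algebra.algebraMap_eq_smul_one, CrossedProduct.coeff_one]
  map_star' a := by
    simp only [CrossedProduct.coeff_star, inducedAction_apply, hx, ContinuousMap.star_apply,
      star_sum, star_mul']
    refine Fintype.sum_equiv (Equiv.inv Γ) _ _ fun g => ?_
    simp [← Circle.coe_inv_eq_conj]

theorem CrossedProduct.fixedPointHom_apply {Γ : Type*} [Group Γ] [Fintype Γ] [DecidableEq Γ]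
    {X : Type*} [TopologicalSpace X] [CompactSpace X] {β : Γ →* (X ≃ₜ X)} {x : X}
    (hx : ∀ g, β g x = x) (χ : Γ →* Circle) (a : CrossedProduct (inducedAction β)) :
    CrossedProduct.fixedPointHom hx χ a = ∑ g, a.coeff g x * χ g := rfl

/-- If the translates of a clopen set under an action of `ℤ/kℤ` partition `X`, then `C(X)` contains
a `k`-th root of `1` which is an eigenvector of the action. -/
theorem exists_eigenvector_pow_eq_one {k : ℕ} [NeZero k] {X : Type*} [TopologicalSpace X]
    (α : Multiplicative (ZMod k) →* (X ≃ₜ X)) {Y : Set X} (hY : IsOpen Y)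
    (hcover : ⋃ j, α j '' Y = Set.univ)
    (hdisj : Pairwise (Function.onFun Disjoint fun j => α j '' Y)) :
    ∃ u : C(X, ℂ), u ^ k = 1 ∧
      ∀ j, inducedAction α j u = (ZMod.toCircle (-j.toAdd) : ℂ) • u := by
  have hmem : ∀ x, ∃ j, x ∈ α j '' Y := fun x => Set.mem_iUnion.1 (hcover ▸ Set.mem_univ x)
  choose d hd using hmem
  have huniq : ∀ {x j}, x ∈ α j '' Y → d x = j := fun {x j} hj => by
    by_contra hne
    exact Set.disjoint_left.1 (hdisj hne) (hd x) hj
  have hloc : IsLocallyConstant d := by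
    -- The fibres of the index function `d` are exactly the translates of `Y`.
    refine IsLocallyConstant.iff_isOpen_fiber.2 fun j => ?_
    have : d ⁻¹' {j} = α j '' Y :=
      Set.ext fun x => ⟨fun h => h ▸ hd x, fun h => huniq h⟩
    rw [this]
    exact (α j).isOpenMap _ hY
  have hshift : ∀ j x, d (α j⁻¹ x) = j⁻¹ * d x := fun j x => by
    obtain ⟨y, hy, hyx⟩ := hd x
    exact huniq ⟨y, hy, by rw [map_mul, Homeomorph.mul_apply, hyx]⟩
  -- The eigenvector equals `ω^j` on the translate `α_j(Y)`; the inverse in `hshift` is what makes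
  -- the eigenvalue `ω^(-j)`.
  refine ⟨⟨fun x => (ZMod.toCircle (d x).toAdd : ℂ), (hloc.comp fun j => (ZMod.toCircle j.toAdd : ℂ)).continuous⟩, ?_, fun j => ?_⟩
  · ext x
    change (ZMod.toCircle (d x).toAdd : ℂ) ^ k = 1
    rw [← Circle.coe_pow, ← AddChar.map_nsmul_eq_pow]
    simp
  · ext x
    change (ZMod.toCircle (d (α j⁻¹ x)).toAdd : ℂ) = _ * (ZMod.toCircle (d x).toAdd : ℂ)
    rw [hshift, toAdd_mul, toAdd_inv, AddChar.map_add_eq_mul, Circle.coe_mul]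

theorem mainTheorem6 (k : ℕ) [NeZero k] (hk : 2 ≤ k)
    (X : Type*) [TopologicalSpace X] [CompactSpace X] [T2Space X] (hX : ¬ ConnectedSpace X)
    (α β : Multiplicative (ZMod k) →* (X ≃ₜ X)) (hαβ : ∀ i j, Commute (α i) (β j))
    (hfix : {x : X | ∀ j, β j x = x}.Nonempty)
    (Y : Set X) (hY : IsClopen Y)
    (hcover : ⋃ j, α j '' Y = Set.univ)
    (hdisj : Pairwise (Function.onFun Disjoint fun j => α j '' Y)) :
    ¬ ∃ φ : C(X, ℂ) →⋆ₐ[ℂ] TwistedJoin (inducedAction β),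
      ∀ (j : Multiplicative (ZMod k)) (f : C(X, ℂ)),
        φ (inducedAction α j f) =
          tildeAction (inducedAction α) (inducedAction β) (inducedAction_commute hαβ) j (φ f) := by
  rintro ⟨φ, hφ⟩
  obtain ⟨x, hx⟩ := hfix
  obtain ⟨u, hu, heig⟩ := exists_eigenvector_pow_eq_one α hY.isOpen hcover hdisj
  have hroot (χ : Multiplicative (ZMod k) →* Circle) (t : unitInterval) :
      CrossedProduct.fixedPointHom hx χ ((φ u).1 t) ^ k = 1 := by
    have h : ((φ u).1 ^ k) t = 1 := by
      have := congrArg Subtype.val ((map_pow φ u k).symm.trans (by rw [hu, map_one]))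
      exact DFunLike.congr_fun this t
    rw [← map_pow, ← ContinuousMap.pow_apply, h, map_one]
  -- The character of the crossed product given by `x` and `χ` is constant along the path `φ u`.
  have hconst (χ : Multiplicative (ZMod k) →* Circle) :
      CrossedProduct.fixedPointHom hx χ ((φ u).1 0) =
        CrossedProduct.fixedPointHom hx χ ((φ u).1 1) :=
    eq_of_continuous_of_pow_eq_one (NeZero.pos k)
      (g := fun t => CrossedProduct.fixedPointHom hx χ ((φ u).1 t))
      ((map_continuous (CrossedProduct.fixedPointHom hx χ)).comp (φ u).1.continuous)
      (hroot χ) 0 1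
  -- The starting point of the path is a scalar multiple of the group element `μ⁻¹`.
  have hzero (g : Multiplicative (ZMod k)) (hg : g ≠ .ofAdd (-1)) :
      ((φ u).1 0).coeff g x = 0 := by
    have h := congrArg (fun f => (f.1 0).coeff g) (hφ (.ofAdd 1) u)
    obtain ⟨c, hc⟩ := (φ u).2.1 g
    -- Equivariance under the generator, read in degree `g` at time 0: the left factor is the
    -- eigenvalue of `u`, the right one comes from the dual action, and `α` fixes the scalar `c`.
    have h' : (ZMod.toCircle (-1 : ZMod k) : ℂ) * c = (ZMod.toCircle g.toAdd : ℂ) * c := by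
      have e1 : ((φ (inducedAction α (.ofAdd 1) u)).1 0).coeff g =
          (ZMod.toCircle (-1 : ZMod k) : ℂ) • ((φ u).1 0).coeff g := by
        rw [heig, map_smul]; rfl
      have e2 : ((tildeAction (inducedAction α) (inducedAction β) (inducedAction_commute hαβ)
          (.ofAdd 1) (φ u)).1 0).coeff g =
          (zmodChar k (.ofAdd 1) g : ℂ) • inducedAction α (.ofAdd 1) (((φ u).1 0).coeff g) := rfl
      have e3 := DFunLike.congr_fun (e1.symm.trans (h.trans e2)) x
      simpa [hc, zmodChar, AlgHomClass.commutes] using e3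
    have hc0 : c = 0 := by
      by_contra hne
      have := mul_right_cancel₀ hne h'
      exact hg (congrArg Multiplicative.ofAdd
        (ZMod.injective_toCircle (Circle.coe_injective this))).symm
    simp [hc, hc0]
  have hleft (χ : Multiplicative (ZMod k) →* Circle) :
      CrossedProduct.fixedPointHom hx χ ((φ u).1 0) =
        ((φ u).1 0).coeff (.ofAdd (-1)) x * χ (.ofAdd (-1)) := by
    rw [CrossedProduct.fixedPointHom_apply]
    exact Finset.sum_eq_single _ (fun g _ hg => by rw [hzero g hg, zero_mul]) (by simp)
  -- At time 1 only the identity coefficient survives, and `χ 1 = 1`, so the value is independent of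
  -- `χ`.
  have hright (χ : Multiplicative (ZMod k) →* Circle) :
      CrossedProduct.fixedPointHom hx χ ((φ u).1 1) = ((φ u).1 1).coeff 1 x := by
    rw [CrossedProduct.fixedPointHom_apply, Finset.sum_eq_single 1]
    · simp
    · intro g _ hg
      rw [(φ u).2.2 g hg]; simp
    · simp
  -- Two characters suffice: the trivial one and the generator `m ↦ ω^m`.
  have h1 := (hleft 1).symm.trans ((hconst 1).trans (hright 1))
  have h2 := (hleft (zmodChar k (.ofAdd 1))).symm.trans
    ((hconst _).trans (hright (zmodChar k (.ofAdd 1))))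
  have hne : ((φ u).1 0).coeff (.ofAdd (-1)) x ≠ 0 := fun h0 => by
    have := hroot 1 0
    rw [hleft, h0, zero_mul, zero_pow (NeZero.ne k)] at this
    exact zero_ne_one this
  -- Cancelling the nonzero coefficient leaves `ω^(-1) = 1`, that is `-1 = 0` in `ZMod k`, which
  -- fails for `k ≥ 2`.
  have h3 : ZMod.toCircle ((1 : ZMod k) * -1) = ZMod.toCircle (0 : ZMod k) := by
    rw [AddChar.map_zero_eq_one]
    exact Circle.coe_injective (mul_left_cancel₀ hne (h2.trans h1.symm))
  have : Fact (1 < k) := ⟨hk⟩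
  simpa using ZMod.injective_toCircle h3
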